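/- **Setting.** Let $(\Omega,\sigma,\mathbb R)$ be a minimal continuous flow on a compact metric space $\Omega$, written $\sigma(t,\omega)=\omega\cdot t$. Let $r>0$, let $m$ be a natural number, and let $X=C([-r,0],\mathbb R^m)$ carry the sup-norm (with the maximum norm on $\mathbb R^m$). For $v\in\mathbb R^m$, $v\ge 0$ (resp. $v\gg0$) means that all components of $v$ are nonnegative (resp. positive); for $\phi\in X$, $\phi\ge0$ (resp. $\phi\gg0$) means that $\phi(s)\ge 0$ (resp. $\phi(s)\gg 0$) for all $s\in[-r,0]$; $\phi\ll\psi$ means $\psi-\phi\gg0$. Let $B=[b_{ij}]$ be an $m\times m$ real quasipositive matrix, that is, $b_{ij}\ge0$ for $i\ne j$. Let $$K_B=\{\phi\in X:\ \phi\ge 0,\ \ \phi(t)\ge e^{B(t-s)}\phi(s)\ \text{ for } -r\le s\le t\le 0\},$$ and write $\phi\le_B\psi$ (equivalently, $\psi\ge_B\phi$) if $\psi-\phi\in K_B$. Write $\phi\gg_B0$ if $\phi\in\operatorname{Int}\widetilde K_B$, where $$\operatorname{Int}\widetilde K_B=\{\phi\in X:\ \phi \text{ is Lipschitz},\ \phi\gg0,\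 \text{and for some }\varepsilon>0,\ \ \phi'-B\phi\ge(\varepsilon,\dots,\varepsilon)\ \text{ a.e. on }[-r,0]\};$$ this is the interior, in the Lipschitz norm, of the cone $\widetilde K_B$ of Lipschitz maps $\phi\ge0$ with $\phi'-B\phi\ge0$ a.e. Let $F\colon\Omega\times X\to\mathbb R^m$ satisfy: * **(F1)** $F$ is continuous on $\Omega\times X$; it is of class $C^1$ in the second variable, that is, the Fréchet derivative $D_2F(\omega,\phi)$ with respect to the second variable exists everywhere and is continuous on $\Omega\times X$ (in the operator norm); and $F(\Omega\times X_1)$ is bounded for each bounded $X_1\subset X$. * **(F3)** $F(\omega,\psi)-F(\omega,\phi)\gg B(\psi(0)-\phi(0))$ whenever $\phi\le_B\psi$, $\phi\ll\psi$ and $\omega\in\Omega$. For $\omega\in\Omega$ and $\varphi\in X$ let $y(t,\omega,\varphi)$ be the solution of $y'(t)=F(\omega\cdot t,y_t)$, $t\ge0$, with $y(s,\omega,\varphi)=\varphi(s)$ for $s\in[-r,0]$, where $y_t(s)=y(t+s)$ for $s\in[-r,0]$, and put $y_t(\omega,\varphi)(s)=y(t+s,\omega,\varphi)$. These solutions induce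 the skew-product semiflow $\tau(t,\omega,\varphi)=(\omega\cdot t,y_t(\omega,\varphi))$. Assume that $\tau$ is globally defined on $\Omega\times K_B$, that is, $y(t,\omega,\varphi)$ exists for all $t\ge0$ whenever $\omega\in\Omega$ and $\varphi\in K_B$. **Proposition.** Assume in addition that $F(\omega,0)\ge0$ for every $\omega\in\Omega$ and that there is an $\omega_0\in\Omega$ with $F(\omega_0,0)\gg0$. Then $\tau$ is uniformly persistent in $\operatorname{Int}\widetilde K_B$: there is a map $\psi\gg_B0$ such that, for every $\omega\in\Omega$ and every $\varphi\gg_B0$, there is a time $t_0=t_0(\omega,\varphi)\geq 0$ such that $y_t(\omega,\varphi)\ge_B\psi$ for all $t\ge t_0$. -/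

import Mathlib

open scoped Matrix

namespace ExpOrder

/-- The phase space `X = C([-r,0], ℝᵐ)` with the sup-norm; `Fin m → ℝ` carries the maximum norm. -/
abbrev PhaseSpace (r : ℝ) (m : ℕ) : Type := C(Set.Icc (-r) (0 : ℝ), Fin m → ℝ)

/-- The value `φ(0)` of `φ ∈ C([-r,0], ℝᵐ)`. -/
def atZero {r : ℝ} (hr : 0 < r) {m : ℕ} (φ : PhaseSpace r m) : Fin m → ℝ :=
  φ ⟨0, by constructor <;> linarith⟩

/-- The segment `y_t ∈ C([-r,0], ℝᵐ)`, `y_t(s) = y(t+s)`. -/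
def segment (r : ℝ) {m : ℕ} (y : C(ℝ, Fin m → ℝ)) (t : ℝ) : PhaseSpace r m :=
  ⟨fun s => y (t + (s : ℝ)), by fun_prop⟩

/-- `B` is quasipositive (cooperative): its off-diagonal entries are nonnegative. -/
def Quasipositive {m : ℕ} (B : Matrix (Fin m) (Fin m) ℝ) : Prop :=
  ∀ i j, i ≠ j → 0 ≤ B i j

/-- The cone `K_B` of all `φ ≥ 0` in `C([-r,0], ℝᵐ)` with `φ(t) ≥ e^{B(t-s)} φ(s)` for
`-r ≤ s ≤ t ≤ 0`. -/
def cone (r : ℝ) {m : ℕ} (B : Matrix (Fin m) (Fin m) ℝ) : Set (PhaseSpace r m) :=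
  {φ | (∀ s i, 0 ≤ φ s i) ∧
    ∀ s t : Set.Icc (-r) (0 : ℝ), s ≤ t →
      ∀ i, (NormedSpace.exp (((t : ℝ) - (s : ℝ)) • B) *ᵥ φ s) i ≤ φ t i}

/-- The exponential ordering `φ ≤_B ψ`. -/
def LEB {r : ℝ} {m : ℕ} (B : Matrix (Fin m) (Fin m) ℝ) (φ ψ : PhaseSpace r m) : Prop :=
  ψ - φ ∈ cone r B

/-- The strong relation `φ ≪ ψ` of the usual ordering of `C([-r,0], ℝᵐ)`. -/
def StrongLT {r : ℝ} {m : ℕ} (φ ψ : PhaseSpace r m) : Prop :=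
  ∀ s i, φ s i < ψ s i

/-- The derivative `φ'(s)`, for `s` in `[-r,0]`. A Lipschitz `φ` is differentiable at almost every
`s ∈ [-r,0]`. -/
noncomputable def derivAt {r : ℝ} {m : ℕ} (φ : PhaseSpace r m)
    (s : Set.Icc (-r) (0 : ℝ)) : Fin m → ℝ :=
  derivWithin (Set.IccExtend (s.2.1.trans s.2.2) φ) (Set.Icc (-r) 0) s

/-- The interior, in the space `X_L` of Lipschitz functions with the Lipschitz norm, of the cone of
all `φ ∈ X_L` with `φ ≥ 0` and `φ' - B φ ≥ 0` a.e. on `[-r,0]`. It consists of the `φ ∈ X_L` with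
`φ ≫ 0` and, for some `ε > 0`, `φ' - B φ ≥ (ε,…,ε)` a.e. on `[-r,0]`.
We write `φ ≫_B 0` for `φ ∈ interiorCone r B`. -/
def interiorCone (r : ℝ) {m : ℕ} (B : Matrix (Fin m) (Fin m) ℝ) : Set (PhaseSpace r m) :=
  {φ | (∃ L, LipschitzWith L φ) ∧ (∀ s i, 0 < φ s i) ∧
    ∃ ε : ℝ, 0 < ε ∧ ∀ᵐ s : ℝ, ∀ hs : s ∈ Set.Icc (-r) (0 : ℝ),
      ∀ i, ε ≤ derivAt φ ⟨s, hs⟩ i - (B *ᵥ φ ⟨s, hs⟩) i}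

/-- `F` is continuous, of class `C¹` in the second variable (the derivative `D₂F` exists and is
continuous on `Ω × X`), and `F(Ω × X₁)` is bounded for every bounded `X₁ ⊆ X`. -/
structure IsRegular {Ω : Type*} [TopologicalSpace Ω] {r : ℝ} {m : ℕ}
    (F : Ω → PhaseSpace r m → Fin m → ℝ) : Prop where
  continuous : Continuous fun p : Ω × PhaseSpace r m => F p.1 p.2
  differentiable : ∀ ω, Differentiable ℝ (F ω)
  continuous_fderiv : Continuous fun p : Ω × PhaseSpace r m => fderiv ℝ (F p.1) p.2
  bounded : ∀ X₁ : Set (PhaseSpace r m), Bornology.IsBounded X₁ →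
    Bornology.IsBounded {v : Fin m → ℝ | ∃ ω, ∃ φ ∈ X₁, F ω φ = v}

/-- `F(ω,ψ) - F(ω,φ) ≫ B (ψ(0) - φ(0))` whenever `φ ≤_B ψ`, `φ ≪ ψ` and `ω ∈ Ω`. -/
def StrongMonotoneCondition {Ω : Type*} {r : ℝ} (hr : 0 < r) {m : ℕ}
    (B : Matrix (Fin m) (Fin m) ℝ) (F : Ω → PhaseSpace r m → Fin m → ℝ) : Prop :=
  ∀ ω φ ψ, LEB B φ ψ → StrongLT φ ψ →
    ∀ i, (B *ᵥ (atZero hr ψ - atZero hr φ)) i < F ω ψ i - F ω φ i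

/-- The flow `σ` is minimal: every orbit is dense. -/
def IsMinimalFlow {Ω : Type*} [TopologicalSpace Ω] (σ : Flow ℝ Ω) : Prop :=
  ∀ ω, Dense (Set.range fun t : ℝ => σ t ω)

/-- `y` is a solution on `[-r,∞)` of `y'(t) = F(ω·t, y_t)`, `t ≥ 0`, with initial value `φ`
(right derivative at `t = 0`). Only the values of `y` on `[-r,∞)` matter: a continuous function on
`[-r,∞)` is the restriction of a continuous function on `ℝ`. -/
def IsSolution {Ω : Type*} [TopologicalSpace Ω] (σ : Flow ℝ Ω) {r : ℝ} {m : ℕ}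
    (F : Ω → PhaseSpace r m → Fin m → ℝ) (ω : Ω) (φ : PhaseSpace r m)
    (y : C(ℝ, Fin m → ℝ)) : Prop :=
  segment r y 0 = φ ∧
    ∀ t : ℝ, 0 ≤ t → HasDerivWithinAt y (F (σ t ω) (segment r y t)) (Set.Ici 0) t

/-- The semiflow `τ(t,ω,φ) = (ω·t, y_t(ω,φ))` is globally defined on `Ω × K`: every solution with
initial value in `K` exists on `[-r,∞)`. -/
def GloballyDefinedOn {Ω : Type*} [TopologicalSpace Ω] (σ : Flow ℝ Ω) {r : ℝ} {m : ℕ}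
    (F : Ω → PhaseSpace r m → Fin m → ℝ) (K : Set (PhaseSpace r m)) : Prop :=
  ∀ ω, ∀ φ ∈ K, ∃ y, IsSolution σ F ω φ y

/-- The semiflow is uniformly persistent in the interior of the positive cone of the exponential
ordering: there is `ψ ≫_B 0` such that for all `ω` and `φ ≫_B 0` the solution `y(·,ω,φ)` exists on
`[-r,∞)` and satisfies `y_t(ω,φ) ≥_B ψ` for all `t ≥ t₀`, for some `t₀ = t₀(ω,φ)`. -/
def UniformlyPersistent {Ω : Type*} [TopologicalSpace Ω] (σ : Flow ℝ Ω) {r : ℝ} {m : ℕ}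
    (B : Matrix (Fin m) (Fin m) ℝ) (F : Ω → PhaseSpace r m → Fin m → ℝ) : Prop :=
  ∃ ψ ∈ interiorCone r B, ∀ ω, ∀ φ ∈ interiorCone r B,
    (∃ y, IsSolution σ F ω φ y) ∧
    ∃ t₀ : ℝ, 0 ≤ t₀ ∧ ∀ y, IsSolution σ F ω φ y → ∀ t, t₀ ≤ t → LEB B ψ (segment r y t)

end ExpOrder

/-! The function `y' - B y` measures how far a solution is from the linear flow of `B`. Since
`e^{uB}` is entrywise nonnegative for `u ≥ 0`, `y' ≥ B y` makes `e^{-uB} y(u)` increase and keeps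
segments in the cone. Comparing with 0 in (F3), and using `F(ω,0) ≥ 0`, gives `y' - B y > 0` for all
time (`IsSolution.mulVec_lt`). Uniformity comes from minimality: every orbit returns, within bounded
time, to a neighbourhood of `ω₀` where `F(·,0) > δ`. Each visit lifts `y` above a level independent
of the initial datum, and the decay between visits is controlled, so eventually `y ≥ c`
(`exists_eventual_lower_bound`). Then (F3), applied against a fixed solution of `χ' = Bχ` below `y`,
and compactness of `Ω` give `y' - B y ≥ ε` (`exists_eventual_forcing`). These two bounds place every
late segment above one small exponential profile (`expProfile_le_segment`). -/

namespace ExpOrder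

open NormedSpace Set MeasureTheory Filter Topology

/-! ### Exponentials of quasipositive matrices -/

section MatrixExponential

attribute [local instance] Matrix.linftyOpNormedRing Matrix.linftyOpNormedAlgebra

variable {m : ℕ}

/-- Every term of the exponential series is entrywise nonnegative; only the zeroth term, the
identity, is kept. -/
theorem one_le_exp_of_nonneg (C : Matrix (Fin m) (Fin m) ℝ) (hC : ∀ i j, 0 ≤ C i j) (i j : Fin m) :
    (1 : Matrix (Fin m) (Fin m) ℝ) i j ≤ exp C i j := by
  have hpow : ∀ (n : ℕ) i j, 0 ≤ (C ^ n) i j := by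
    intro n
    induction n with
    | zero => intro i j; rw [pow_zero, Matrix.one_apply]; split_ifs <;> norm_num
    | succ n ih =>
      intro i j
      rw [pow_succ, Matrix.mul_apply]
      exact Finset.sum_nonneg fun k _ => mul_nonneg (ih i k) (hC k j)
  have hsum : HasSum (fun n : ℕ => ((n.factorial : ℝ)⁻¹ • C ^ n) i j) (exp C i j) := by
    have h := NormedSpace.exp_series_hasSum_exp' (𝕂 := ℝ) C
    exact Pi.hasSum.1 (Pi.hasSum.1 h i) j
  have h := hsum.summable.sum_le_tsum {0} (fun n _ => by
    simpa using mul_nonneg (inv_nonneg.2 (Nat.cast_nonneg _)) (hpow n i j))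
  rw [hsum.tsum_eq] at h
  simpa using h

theorem exp_add_smul (B : Matrix (Fin m) (Fin m) ℝ) (a b : ℝ) :
    exp ((a + b) • B) = exp (a • B) * exp (b • B) := by
  rw [add_smul]
  exact Matrix.exp_add_of_commute _ _ (((Commute.refl B).smul_left a).smul_right b)

theorem hasDerivAt_exp_sub (B : Matrix (Fin m) (Fin m) ℝ) (t u : ℝ) :
    HasDerivAt (fun u : ℝ => exp ((t - u) • B)) (-(exp ((t - u) • B) * B)) u := by
  have h := (hasDerivAt_exp_smul_const (𝕂 := ℝ) B (t - u)).scomp u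
    ((hasDerivAt_id u).const_sub t)
  rw [neg_one_smul] at h
  exact h

theorem hasDerivAt_exp_sub_apply (B : Matrix (Fin m) (Fin m) ℝ) (t u : ℝ) (i j : Fin m) :
    HasDerivAt (fun u : ℝ => exp ((t - u) • B) i j) ((-(exp ((t - u) • B) * B)) i j) u :=
  hasDerivAt_pi.1 (hasDerivAt_pi.1 (hasDerivAt_exp_sub B t u) i) j

theorem hasDerivAt_exp_mulVec (B : Matrix (Fin m) (Fin m) ℝ) (t : ℝ) {w : ℝ → Fin m → ℝ}
    {w' : Fin m → ℝ} {u : ℝ} (hw : HasDerivAt w w' u) :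
    HasDerivAt (fun u => exp ((t - u) • B) *ᵥ w u)
      (exp ((t - u) • B) *ᵥ (w' - B *ᵥ w u)) u := by
  rw [hasDerivAt_pi]
  intro i
  have h3 := HasDerivAt.fun_sum (u := Finset.univ)
    (fun j _ => (hasDerivAt_exp_sub_apply B t u i j).mul (hasDerivAt_pi.1 hw j))
  refine (h3.congr_deriv ?_)
  rw [Matrix.mulVec_sub, Matrix.mulVec_mulVec, Pi.sub_apply, Finset.sum_add_distrib]
  simp only [Matrix.mulVec, dotProduct, Matrix.neg_apply, neg_mul, Finset.sum_neg_distrib]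
  ring

theorem contDiff_exp_apply (B : Matrix (Fin m) (Fin m) ℝ) (t : ℝ) (i j : Fin m) :
    ContDiff ℝ 1 (fun u : ℝ => exp ((t - u) • B) i j) := by
  refine contDiff_one_iff_deriv.2
    ⟨fun u => (hasDerivAt_exp_sub_apply B t u i j).differentiableAt, ?_⟩
  rw [funext fun u => (hasDerivAt_exp_sub_apply B t u i j).deriv]
  have hc : Continuous fun u : ℝ => exp ((t - u) • B) :=
    (NormedSpace.exp_continuous).comp (by fun_prop)
  have : Continuous fun u : ℝ => -(exp ((t - u) • B) * B) := (hc.mul continuous_const).neg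
  exact this.matrix_elem i j

/-- A scalar matrix commutes with everything, so a diagonal shift factors out; this reduces
quasipositive matrices to nonnegative ones. -/
theorem exp_smul_eq_scalar_shift (B : Matrix (Fin m) (Fin m) ℝ) (β u : ℝ) :
    exp (u • B) = Real.exp (-(β * u)) • exp (u • (B + β • (1 : Matrix (Fin m) (Fin m) ℝ))) := by
  have h : u • B = (-(β * u)) • (1 : Matrix (Fin m) (Fin m) ℝ)
      + u • (B + β • (1 : Matrix (Fin m) (Fin m) ℝ)) := by
    rw [smul_add, smul_smul]
    module
  have hs : exp ((-(β * u)) • (1 : Matrix (Fin m) (Fin m) ℝ))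
      = Real.exp (-(β * u)) • (1 : Matrix (Fin m) (Fin m) ℝ) := by
    rw [← Matrix.diagonal_one, ← Matrix.diagonal_smul, Matrix.exp_diagonal, ← Matrix.diagonal_smul]
    congr 1
    funext i
    rw [Pi.coe_exp]
    simp [Real.exp_eq_exp_ℝ]
  conv_lhs => rw [h]
  rw [Matrix.exp_add_of_commute _ _ ((Commute.one_left _).smul_left _), hs, smul_mul_assoc, one_mul]

end MatrixExponential

variable {m : ℕ}

/-- A constant dominating the negative part of the diagonal of `B`. -/
def shift (B : Matrix (Fin m) (Fin m) ℝ) : ℝ := ∑ i, |B i i|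

theorem shift_nonneg (B : Matrix (Fin m) (Fin m) ℝ) : 0 ≤ shift B :=
  Finset.sum_nonneg fun _ _ => abs_nonneg _

theorem exp_apply_ge {B : Matrix (Fin m) (Fin m) ℝ} (hB : Quasipositive B) {u : ℝ} (hu : 0 ≤ u)
    (i j : Fin m) :
    Real.exp (-(shift B * u)) * (1 : Matrix (Fin m) (Fin m) ℝ) i j ≤ exp (u • B) i j := by
  rw [exp_smul_eq_scalar_shift B (shift B) u, Matrix.smul_apply, smul_eq_mul]
  refine mul_le_mul_of_nonneg_left (one_le_exp_of_nonneg _ (fun k l => ?_) i j) (Real.exp_pos _).le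
  refine mul_nonneg hu ?_
  by_cases hkl : k = l
  · subst hkl
    have := Finset.single_le_sum (f := fun i => |B i i|) (fun i _ => abs_nonneg _)
      (Finset.mem_univ k)
    have h2 := neg_abs_le (B k k)
    simp only [Matrix.add_apply, Matrix.smul_apply, Matrix.one_apply_eq, smul_eq_mul, mul_one, shift]
    linarith
  · simpa [Matrix.one_apply_ne hkl] using hB k l hkl

/-- Quantitative positivity: a component decays at rate at most `shift B`, whatever the other
nonnegative components do. -/
theorem exp_mulVec_ge {B : Matrix (Fin m) (Fin m) ℝ} (hB : Quasipositive B) {u : ℝ} (hu : 0 ≤ u)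
    {v : Fin m → ℝ} (hv : ∀ i, 0 ≤ v i) (i : Fin m) :
    Real.exp (-(shift B * u)) * v i ≤ (exp (u • B) *ᵥ v) i := by
  have h : Real.exp (-(shift B * u)) * v i
      = ∑ j, Real.exp (-(shift B * u)) * (1 : Matrix (Fin m) (Fin m) ℝ) i j * v j := by
    simp [Matrix.one_apply]
  rw [h]
  exact Finset.sum_le_sum fun j _ => mul_le_mul_of_nonneg_right (exp_apply_ge hB hu i j) (hv j)

theorem exp_mulVec_nonneg {B : Matrix (Fin m) (Fin m) ℝ} (hB : Quasipositive B) {u : ℝ} (hu : 0 ≤ u)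
    {v : Fin m → ℝ} (hv : ∀ i, 0 ≤ v i) (i : Fin m) : 0 ≤ (exp (u • B) *ᵥ v) i :=
  (mul_nonneg (Real.exp_pos _).le (hv i)).trans (exp_mulVec_ge hB hu hv i)

theorem exp_mulVec_mono {B : Matrix (Fin m) (Fin m) ℝ} (hB : Quasipositive B) {u : ℝ} (hu : 0 ≤ u)
    {v w : Fin m → ℝ} (hvw : ∀ i, v i ≤ w i) (i : Fin m) :
    (exp (u • B) *ᵥ v) i ≤ (exp (u • B) *ᵥ w) i := by
  have h := exp_mulVec_nonneg hB hu (v := w - v) (fun i => sub_nonneg.2 (hvw i)) i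
  rw [Matrix.mulVec_sub, Pi.sub_apply] at h
  linarith

/-! ### Differential inequalities and variation of constants -/

/-- Variation of constants: if `w' ≥ B w` on `(s,t)` then `w(t) ≥ e^{B(t-s)} w(s)`. -/
theorem exp_mulVec_le_of_hasDerivAt {B : Matrix (Fin m) (Fin m) ℝ} (hB : Quasipositive B)
    {w w' : ℝ → Fin m → ℝ} {s t : ℝ} (hst : s ≤ t) (hc : ContinuousOn w (Icc s t))
    (hd : ∀ u ∈ Ioo s t, HasDerivAt w (w' u) u)
    (hle : ∀ u ∈ Ioo s t, ∀ i, (B *ᵥ w u) i ≤ w' u i) (i : Fin m) :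
    (exp ((t - s) • B) *ᵥ w s) i ≤ w t i := by
  have hD : ∀ u ∈ Ioo s t, HasDerivAt (fun u => (exp ((t - u) • B) *ᵥ w u) i)
      ((exp ((t - u) • B) *ᵥ (w' u - B *ᵥ w u)) i) u :=
    fun u hu => hasDerivAt_pi.1 (hasDerivAt_exp_mulVec B t (hd u hu)) i
  have hcont : ContinuousOn (fun u => (exp ((t - u) • B) *ᵥ w u) i) (Icc s t) := by
    simp only [Matrix.mulVec, dotProduct]
    exact continuousOn_finsetSum _ fun j _ =>
      (contDiff_exp_apply B t i j).continuous.continuousOn.mul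
        ((continuous_apply j).comp_continuousOn hc)
  have hmono : MonotoneOn (fun u => (exp ((t - u) • B) *ᵥ w u) i) (Icc s t) := by
    refine monotoneOn_of_deriv_nonneg (convex_Icc s t) hcont ?_ ?_
    · rw [interior_Icc]
      exact fun u hu => (hD u hu).differentiableAt.differentiableWithinAt
    · rw [interior_Icc]
      intro u hu
      rw [(hD u hu).deriv]
      exact exp_mulVec_nonneg hB (sub_nonneg.2 hu.2.le) (fun j => sub_nonneg.2 (hle u hu j)) i
  simpa using hmono (left_mem_Icc.2 hst) (right_mem_Icc.2 hst) hst

theorem absolutelyContinuousOnInterval_sum {ι : Type*} (S : Finset ι) {f : ι → ℝ → ℝ} {a b : ℝ}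
    (hf : ∀ i ∈ S, AbsolutelyContinuousOnInterval (f i) a b) :
    AbsolutelyContinuousOnInterval (fun u => ∑ i ∈ S, f i u) a b := by
  classical
  induction S using Finset.induction_on with
  | empty =>
    simp only [Finset.sum_empty]
    exact (LipschitzWith.const (0 : ℝ)).lipschitzOnWith.absolutelyContinuousOnInterval
  | insert i S hi ih =>
    simp only [Finset.sum_insert hi]
    exact (hf i (Finset.mem_insert_self i S)).add
      (ih fun j hj => hf j (Finset.mem_insert_of_mem hj))

/-- The almost everywhere version of variation of constants, for Lipschitz `w`. -/
theorem exp_mulVec_le_of_ae {B : Matrix (Fin m) (Fin m) ℝ} (hB : Quasipositive B)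
    {w : ℝ → Fin m → ℝ} {s t : ℝ} (hst : s ≤ t) {L : NNReal} (hL : LipschitzWith L w)
    (hle : ∀ᵐ u : ℝ, u ∈ Ioo s t → ∀ i, (B *ᵥ w u) i ≤ deriv w u i) (i : Fin m) :
    (exp ((t - s) • B) *ᵥ w s) i ≤ w t i := by
  -- An a.e. sign of the derivative controls the increment only because the function is absolutely
  -- continuous.
  have hac : AbsolutelyContinuousOnInterval (fun u => (exp ((t - u) • B) *ᵥ w u) i) s t := by
    simp only [Matrix.mulVec, dotProduct]
    refine absolutelyContinuousOnInterval_sum _ fun j _ => ?_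
    refine (contDiff_exp_apply B t i j).contDiffOn.absolutelyContinuousOnInterval.fun_mul ?_
    have hLj : LipschitzWith L (fun u => w u j) := by
      simpa [Function.comp_def] using (LipschitzWith.eval j).comp hL
    exact hLj.lipschitzOnWith.absolutelyContinuousOnInterval
  have hint := hac.integral_deriv_eq_sub
  have hpos : 0 ≤ ∫ u in s..t, deriv (fun u => (exp ((t - u) • B) *ᵥ w u) i) u := by
    refine intervalIntegral.integral_nonneg_of_ae_restrict hst ?_
    rw [EventuallyLE, ae_restrict_iff' measurableSet_Icc]
    filter_upwards [hle, hL.ae_differentiableAt_real,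
      Measure.ae_ne volume s, Measure.ae_ne volume t] with u hu hdu hus hut hmem
    have hmem' : u ∈ Ioo s t := ⟨lt_of_le_of_ne hmem.1 (Ne.symm hus), lt_of_le_of_ne hmem.2 hut⟩
    have hD := hasDerivAt_pi.1 (hasDerivAt_exp_mulVec B t hdu.hasDerivAt) i
    rw [Pi.zero_apply, hD.deriv]
    exact exp_mulVec_nonneg hB (sub_nonneg.2 hmem.2) (fun j => sub_nonneg.2 (hu hmem' j)) i
  rw [hint] at hpos
  simpa using hpos

/-- The constant extension of `φ` beyond the interval is Lipschitz on `ℝ`, so the a.e. variation of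
constants applies to it. -/
theorem interiorCone_subset_cone {r : ℝ} (hr : 0 < r) {B : Matrix (Fin m) (Fin m) ℝ}
    (hB : Quasipositive B) : interiorCone r B ⊆ cone r B := by
  rintro φ ⟨⟨L, hL⟩, hpos, ε, hε, hae⟩
  have hr' : -r ≤ 0 := by linarith
  refine ⟨fun s i => (hpos s i).le, fun s t hst i => ?_⟩
  have hLw : LipschitzWith (L * 1) (IccExtend hr' φ) := hL.comp (LipschitzWith.projIcc hr')
  have h := exp_mulVec_le_of_ae hB (w := IccExtend hr' φ) (s := s) (t := t) hst hLw ?_ i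
  · simpa using h
  · filter_upwards [hae] with u hu hmem j
    have hu0 : u ∈ Ioo (-r) 0 := ⟨s.2.1.trans_lt hmem.1, hmem.2.trans_le t.2.2⟩
    have hu1 : u ∈ Icc (-r) 0 := Ioo_subset_Icc_self hu0
    have h := hu hu1 j
    have hd : derivAt φ ⟨u, hu1⟩ = deriv (IccExtend hr' φ) u :=
      derivWithin_of_mem_nhds (Icc_mem_nhds hu0.1 hu0.2)
    rw [hd] at h
    rw [IccExtend_of_mem hr' φ hu1]
    linarith

/-! ### Exponential profiles -/

/-- The sum of the absolute values of all entries of `B`. -/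
def entrySum (B : Matrix (Fin m) (Fin m) ℝ) : ℝ := ∑ i, ∑ j, |B i j|

theorem entrySum_nonneg (B : Matrix (Fin m) (Fin m) ℝ) : 0 ≤ entrySum B :=
  Finset.sum_nonneg fun _ _ => Finset.sum_nonneg fun _ _ => abs_nonneg _

theorem abs_mulVec_const_le (B : Matrix (Fin m) (Fin m) ℝ) {a : ℝ} (ha : 0 ≤ a) (i : Fin m) :
    |(B *ᵥ fun _ => a) i| ≤ entrySum B * a := by
  have h1 : ∑ j, |B i j| ≤ entrySum B :=
    Finset.single_le_sum (f := fun i => ∑ j, |B i j|)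
      (fun i _ => Finset.sum_nonneg fun _ _ => abs_nonneg _) (Finset.mem_univ i)
  have h2 : (B *ᵥ fun _ => a) i = (∑ j, B i j) * a := by
    simp [Matrix.mulVec, dotProduct, Finset.sum_mul]
  rw [h2, abs_mul, abs_of_nonneg ha]
  exact mul_le_mul_of_nonneg_right ((Finset.abs_sum_le_sum_abs _ _).trans h1) ha

/-- The map `s ↦ κ e^{(1 + b) s} (1,…,1)`, where `b` is the sum of the absolute values of the
entries of `B`. -/
noncomputable def expProfile (r : ℝ) (B : Matrix (Fin m) (Fin m) ℝ) (κ : ℝ) : PhaseSpace r m :=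
  ⟨fun s _ => κ * Real.exp ((1 + entrySum B) * s), by fun_prop⟩

theorem hasDerivAt_expProfile (B : Matrix (Fin m) (Fin m) ℝ) (κ u : ℝ) :
    HasDerivAt (fun u (_ : Fin m) => κ * Real.exp ((1 + entrySum B) * u))
      (fun _ => κ * (Real.exp ((1 + entrySum B) * u) * (1 + entrySum B))) u := by
  rw [hasDerivAt_pi]
  intro _
  have h := ((hasDerivAt_id u).const_mul (1 + entrySum B)).exp.const_mul κ
  simpa using h

/-- With `b = entrySum B`, the profile satisfies `φ' = (1 + b) φ` and `Bφ ≤ b φ`, so `φ' - Bφ ≥ φ ≥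
φ(-r)`, which serves as `ε`. -/
theorem expProfile_mem_interiorCone {r : ℝ} (hr : 0 < r) (B : Matrix (Fin m) (Fin m) ℝ) {κ : ℝ}
    (hκ : 0 < κ) : expProfile r B κ ∈ interiorCone r B := by
  have hb := entrySum_nonneg B
  refine ⟨?_, fun s i => mul_pos hκ (Real.exp_pos _), κ * Real.exp ((1 + entrySum B) * (-r)),
    mul_pos hκ (Real.exp_pos _), ?_⟩
  · have hC : ContDiffOn ℝ 1 (fun u (_ : Fin m) => κ * Real.exp ((1 + entrySum B) * u))
        (Icc (-r) 0) := by fun_prop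
    obtain ⟨K, hK⟩ := hC.exists_lipschitzOnWith (by decide) (convex_Icc _ _) isCompact_Icc
    exact ⟨K, hK.to_restrict⟩
  · refine ae_of_all _ fun s hs i => ?_
    have hd : derivAt (expProfile r B κ) ⟨s, hs⟩
        = fun _ => κ * (Real.exp ((1 + entrySum B) * s) * (1 + entrySum B)) := by
      have h := (hasDerivAt_expProfile (m := m) B κ s).hasDerivWithinAt (s := Icc (-r) 0)
      refine (h.congr_of_mem (fun u hu => ?_) hs).derivWithin
        (uniqueDiffOn_Icc (by linarith) s hs)
      rw [IccExtend_of_mem _ _ hu]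
      rfl
    rw [hd]
    have h1 : 0 ≤ κ * Real.exp ((1 + entrySum B) * s) := (mul_pos hκ (Real.exp_pos _)).le
    have h2 := (abs_le.1 (abs_mulVec_const_le B h1 i)).2
    have h3 : κ * Real.exp ((1 + entrySum B) * (-r)) ≤ κ * Real.exp ((1 + entrySum B) * s) :=
      mul_le_mul_of_nonneg_left (Real.exp_le_exp.2
        (mul_le_mul_of_nonneg_left hs.1 (by linarith))) hκ.le
    have h4 : (B *ᵥ (expProfile r B κ) ⟨s, hs⟩) i
        = (B *ᵥ fun _ => κ * Real.exp ((1 + entrySum B) * s)) i := rfl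
    rw [h4]
    linarith

/-! ### Invariance of the cone under `y' ≥ B y` -/

theorem continuous_segment (r : ℝ) (y : C(ℝ, Fin m → ℝ)) : Continuous (segment r y) := by
  let f : C(ℝ × Icc (-r) (0 : ℝ), Fin m → ℝ) := ⟨fun p => y (p.1 + p.2), by fun_prop⟩
  exact f.curry.continuous

theorem atZero_segment {r : ℝ} (hr : 0 < r) (y : C(ℝ, Fin m → ℝ)) (t : ℝ) :
    atZero hr (segment r y t) = y t := by
  simp [atZero, segment]

/-- A solution of the differential inequality `y' ≥ B y` starting in the cone satisfies the
inequality which defines the cone on its whole interval of definition. -/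
theorem exp_mulVec_le_of_segment_zero {r : ℝ} {B : Matrix (Fin m) (Fin m) ℝ}
    (hB : Quasipositive B) {y : C(ℝ, Fin m → ℝ)} (h0 : segment r y 0 ∈ cone r B)
    {y' : ℝ → Fin m → ℝ} {T : ℝ} (hd : ∀ u ∈ Ioo 0 T, HasDerivAt y (y' u) u)
    (hle : ∀ u ∈ Ioo 0 T, ∀ i, (B *ᵥ y u) i ≤ y' u i) {s t : ℝ} (hs : -r ≤ s) (hst : s ≤ t)
    (htT : t ≤ T) (i : Fin m) : (exp ((t - s) • B) *ᵥ y s) i ≤ y t i := by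
  have hneg : ∀ s t : ℝ, -r ≤ s → s ≤ t → t ≤ 0 → ∀ i, (exp ((t - s) • B) *ᵥ y s) i ≤ y t i := by
    intro s t hs hst ht i
    have h := h0.2 ⟨s, hs, hst.trans ht⟩ ⟨t, hs.trans hst, ht⟩ hst i
    simpa [segment] using h
  have hpos : ∀ s t : ℝ, 0 ≤ s → s ≤ t → t ≤ T → ∀ i, (exp ((t - s) • B) *ᵥ y s) i ≤ y t i := by
    intro s t hs hst ht i
    have hsub : Ioo s t ⊆ Ioo 0 T := Ioo_subset_Ioo hs ht
    exact exp_mulVec_le_of_hasDerivAt hB hst y.continuous.continuousOn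
      (fun u hu => hd u (hsub hu)) (fun u hu => hle u (hsub hu)) i
  rcases le_total t 0 with ht | ht
  · exact hneg s t hs hst ht i
  rcases le_total 0 s with hs0 | hs0
  · exact hpos s t hs0 hst htT i
  -- When `s ≤ 0 ≤ t`, the two inequalities are chained at time 0 by the semigroup property.
  have h1 := exp_mulVec_mono hB ht (hneg s 0 hs hs0 le_rfl) i
  have h2 := hpos 0 t le_rfl ht htT i
  rw [Matrix.mulVec_mulVec, ← exp_add_smul] at h1
  rw [sub_zero] at h2
  have h3 : t + (0 - s) = t - s := by ring
  rw [h3] at h1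
  exact h1.trans h2

theorem pos_of_segment_zero {r : ℝ} (hr : 0 < r) {B : Matrix (Fin m) (Fin m) ℝ}
    (hB : Quasipositive B) {y : C(ℝ, Fin m → ℝ)} (h0 : segment r y 0 ∈ cone r B)
    (h0pos : ∀ s i, 0 < segment r y 0 s i)
    {y' : ℝ → Fin m → ℝ} {T : ℝ} (hd : ∀ u ∈ Ioo 0 T, HasDerivAt y (y' u) u)
    (hle : ∀ u ∈ Ioo 0 T, ∀ i, (B *ᵥ y u) i ≤ y' u i) {t : ℝ} (ht : -r ≤ t)
    (htT : t ≤ T) (i : Fin m) : 0 < y t i := by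
  have hneg : ∀ t : ℝ, -r ≤ t → t ≤ 0 → ∀ i, 0 < y t i := by
    intro t ht ht0 i
    simpa [segment] using h0pos ⟨t, ht, ht0⟩ i
  rcases le_total t 0 with ht0 | ht0
  · exact hneg t ht ht0 i
  have h1 := exp_mulVec_le_of_segment_zero hB h0 hd hle (by linarith) ht0 htT i
  have hy0 := hneg 0 (by linarith) le_rfl
  have h2 := exp_mulVec_ge hB (sub_nonneg.2 ht0) (fun i => (hy0 i).le) i
  exact (mul_pos (Real.exp_pos _) (hy0 i)).trans_le (h2.trans h1)

theorem segment_mem_cone {r : ℝ} (hr : 0 < r) {B : Matrix (Fin m) (Fin m) ℝ}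
    (hB : Quasipositive B) {y : C(ℝ, Fin m → ℝ)} (h0 : segment r y 0 ∈ cone r B)
    (h0pos : ∀ s i, 0 < segment r y 0 s i)
    {y' : ℝ → Fin m → ℝ} {T : ℝ} (hT : 0 ≤ T) (hd : ∀ u ∈ Ioo 0 T, HasDerivAt y (y' u) u)
    (hle : ∀ u ∈ Ioo 0 T, ∀ i, (B *ᵥ y u) i ≤ y' u i) : segment r y T ∈ cone r B := by
  refine ⟨fun s i => (pos_of_segment_zero hr hB h0 h0pos hd hle ?_ ?_ i).le,
    fun s t hst i => ?_⟩
  · linarith [s.2.1]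
  · linarith [s.2.2]
  · have h := exp_mulVec_le_of_segment_zero hB h0 hd hle (s := T + s) (t := T + t)
      (by linarith [s.2.1]) (by simpa using hst) (by linarith [t.2.2]) i
    rw [add_sub_add_left_eq_sub] at h
    exact h

section Solutions

variable {Ω : Type*} [TopologicalSpace Ω] {σ : Flow ℝ Ω} {r : ℝ}
  {F : Ω → PhaseSpace r m → Fin m → ℝ}

theorem IsSolution.hasDerivAt {ω : Ω} {φ : PhaseSpace r m} {y : C(ℝ, Fin m → ℝ)}
    (hy : IsSolution σ F ω φ y) {t : ℝ} (ht : 0 < t) :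
    HasDerivAt y (F (σ t ω) (segment r y t)) t :=
  (hy.2 t ht.le).hasDerivAt (Ici_mem_nhds ht)

/-- Strong positivity in the exponential ordering: along a solution starting in `interiorCone r B`,
the expression `y' - B y` stays positive. -/
theorem IsSolution.mulVec_lt (hr : 0 < r) {B : Matrix (Fin m) (Fin m) ℝ}
    (hB : Quasipositive B)
    (hF : Continuous fun p : Ω × PhaseSpace r m => F p.1 p.2)
    (hF3 : StrongMonotoneCondition hr B F) (hF0 : ∀ ω i, 0 ≤ F ω 0 i)
    {ω : Ω} {φ : PhaseSpace r m} (hφ : φ ∈ interiorCone r B) {y : C(ℝ, Fin m → ℝ)}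
    (hy : IsSolution σ F ω φ y) {t : ℝ} (ht : 0 ≤ t) (i : Fin m) :
    (B *ᵥ y t) i < F (σ t ω) (segment r y t) i := by
  have h0 : segment r y 0 ∈ cone r B := by
    rw [hy.1]; exact interiorCone_subset_cone hr hB hφ
  have h0pos : ∀ s i, 0 < segment r y 0 s i := by
    rw [hy.1]; exact hφ.2.1
  have hgc : Continuous fun t => F (σ t ω) (segment r y t) :=
    hF.comp ((σ.continuous continuous_id continuous_const).prodMk (continuous_segment r y))
  have hBc : Continuous fun t => B *ᵥ y t := continuous_const.matrix_mulVec y.continuous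
  -- The times at which some component violates the strict inequality form a closed set, so a first
  -- one exists.
  let S : Set ℝ := Ici 0 ∩ ⋃ i : Fin m, {t | F (σ t ω) (segment r y t) i ≤ (B *ᵥ y t) i}
  have hS : IsClosed S := isClosed_Ici.inter (isClosed_iUnion_of_finite fun i =>
    isClosed_le ((continuous_apply i).comp hgc) ((continuous_apply i).comp hBc))
  by_contra hlt
  have hne : S.Nonempty := ⟨t, ht, mem_iUnion.2 ⟨i, not_lt.1 hlt⟩⟩
  have hbdd : BddBelow S := ⟨0, fun u hu => hu.1⟩
  obtain ⟨hT, hT'⟩ := hS.csInf_mem hne hbdd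
  obtain ⟨j, hj⟩ := mem_iUnion.1 hT'
  have hd : ∀ u ∈ Ioo 0 (sInf S), HasDerivAt y (F (σ u ω) (segment r y u)) u :=
    fun u hu => hy.hasDerivAt hu.1
  have hle : ∀ u ∈ Ioo 0 (sInf S), ∀ i, (B *ᵥ y u) i ≤ F (σ u ω) (segment r y u) i := by
    intro u hu i
    by_contra h
    exact notMem_of_lt_csInf hu.2 hbdd ⟨hu.1.le, mem_iUnion.2 ⟨i, (not_le.1 h).le⟩⟩
  have hmem := segment_mem_cone hr hB h0 h0pos hT hd hle
  have hlt' : StrongLT 0 (segment r y (sInf S)) := fun s i =>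
    pos_of_segment_zero hr hB h0 h0pos hd hle (t := sInf S + s)
      (by linarith [s.2.1, mem_Ici.1 hT]) (by linarith [s.2.2]) i
  -- Up to the first violation `y' ≥ B y`, so the segment there is still in the cone and strictly
  -- positive; (F3) against 0 then forbids the violation.
  have h := hF3 (σ (sInf S) ω) 0 (segment r y (sInf S)) (by simpa [LEB] using hmem) hlt' j
  rw [atZero_segment] at h
  have hz : atZero hr (0 : PhaseSpace r m) = 0 := rfl
  rw [hz, sub_zero] at h
  have hj' : F (σ (sInf S) ω) (segment r y (sInf S)) j ≤ (B *ᵥ y (sInf S)) j := hj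
  linarith [hF0 (σ (sInf S) ω) j]

end Solutions

/-! ### Recurrence, and growth under forcing -/

/-- In a minimal flow on a compact space the forward return times to an open set are relatively
dense. -/
theorem IsMinimalFlow.exists_return_time {Ω : Type*} [TopologicalSpace Ω] [CompactSpace Ω]
    {σ : Flow ℝ Ω} (hσ : IsMinimalFlow σ) {U : Set Ω} (hU : IsOpen U) (hne : U.Nonempty) :
    ∃ T : ℝ, 0 ≤ T ∧ ∀ ω, ∃ t ∈ Icc 0 T, σ t ω ∈ U := by
  have hopen : ∀ t : ℝ, IsOpen {ω | σ t ω ∈ U} := fun t =>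
    hU.preimage (σ.continuous continuous_const continuous_id)
  have hcover : (univ : Set Ω) ⊆ ⋃ t : ℝ, {ω | σ t ω ∈ U} := by
    intro ω _
    obtain ⟨_, hx, ⟨t, rfl⟩⟩ := (hσ ω).inter_open_nonempty U hU hne
    exact mem_iUnion.2 ⟨t, hx⟩
  obtain ⟨I, hI⟩ := isCompact_univ.elim_finite_subcover _ hopen hcover
  -- The finitely many hitting times may be negative, but lie in `[-T, T]`; starting from `σ T ω`
  -- moves them into `[0, 2T]`.
  let T : ℝ := ∑ t ∈ I, |t|
  have hT : 0 ≤ T := Finset.sum_nonneg fun _ _ => abs_nonneg _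
  refine ⟨T + T, by linarith, fun ω => ?_⟩
  obtain ⟨t, ht, hmem⟩ := mem_iUnion₂.1 (hI (mem_univ (σ T ω)))
  have hle : |t| ≤ T := Finset.single_le_sum (f := fun t : ℝ => |t|) (fun _ _ => abs_nonneg _) ht
  have h := abs_le.1 hle
  refine ⟨t + T, ⟨by linarith, by linarith⟩, ?_⟩
  rw [σ.map_add]
  exact hmem

/-- A positive lower bound after a time interval on which `y' - B y ≥ δ`. -/
theorem lower_bound_of_forcing {B : Matrix (Fin m) (Fin m) ℝ}
    (hB : Quasipositive B) {y y' : ℝ → Fin m → ℝ} {τ η δ : ℝ} (hη : 0 < η) (hδ : 0 < δ)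
    (hc : ContinuousOn y (Icc τ (τ + η)))
    (hd : ∀ u ∈ Ioo τ (τ + η), HasDerivAt y (y' u) u)
    (hle : ∀ u ∈ Ioo τ (τ + η), ∀ i, (B *ᵥ y u) i + δ ≤ y' u i) (hy : ∀ i, 0 ≤ y τ i)
    (i : Fin m) : δ / (1 + entrySum B * η) * η ≤ y (τ + η) i := by
  have hb := entrySum_nonneg B
  -- The slope is chosen so that `d + entrySum B * (d * η) = δ`: then `y` minus the ramp `d (u - τ)`
  -- still satisfies `w' ≥ B w`.
  set d := δ / (1 + entrySum B * η) with hd_def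
  have hden : 0 < 1 + entrySum B * η := by positivity
  have hd0 : 0 < d := by positivity
  have hdδ : d * (1 + entrySum B * η) = δ := div_mul_cancel₀ _ hden.ne'
  have hlin : ∀ u, HasDerivAt (fun u (_ : Fin m) => d * (u - τ)) (fun _ => d) u := by
    intro u
    rw [hasDerivAt_pi]
    intro _
    simpa using ((hasDerivAt_id u).sub_const τ).const_mul d
  have h := exp_mulVec_le_of_hasDerivAt hB (w := fun u => y u - fun _ => d * (u - τ))
    (w' := fun u => y' u - fun _ => d) (s := τ) (t := τ + η) (by linarith)
    (hc.sub (by fun_prop)) (fun u hu => (hd u hu).sub (hlin u)) ?_ i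
  · have h0 := exp_mulVec_nonneg hB (u := τ + η - τ) (by linarith)
      (v := y τ - fun _ => d * (τ - τ)) (by simpa using hy) i
    have h1 := h0.trans h
    simp only [Pi.sub_apply, add_sub_cancel_left] at h1
    linarith
  · intro u hu j
    have h1 := (abs_le.1 (abs_mulVec_const_le B
      (mul_nonneg hd0.le (sub_nonneg.2 hu.1.le)) j)).1
    have h2 := hle u hu j
    have h3 : entrySum B * (d * (u - τ)) ≤ entrySum B * (d * η) := by
      have : u - τ ≤ η := by linarith [hu.2]
      gcongr
    rw [Matrix.mulVec_sub]
    simp only [Pi.sub_apply]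
    nlinarith

/-! ### Comparison functions -/

/-- The curve `s ↦ e^{B(s+r)} (a,…,a)`. -/
noncomputable def linearOrbit (r : ℝ) (B : Matrix (Fin m) (Fin m) ℝ) (a : ℝ) : PhaseSpace r m :=
  ⟨fun s => exp (((s : ℝ) + r) • B) *ᵥ fun _ => a, by
    have h : ∀ s : ℝ, s + r = r - (-s) := fun s => by ring
    refine continuous_pi fun i => ?_
    simp only [Matrix.mulVec, dotProduct]
    refine continuous_finsetSum _ fun j _ => Continuous.mul ?_ continuous_const
    have h2 := (contDiff_exp_apply B r i j).continuous.comp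
      (g := fun u : ℝ => exp ((r - u) • B) i j)
      (f := fun s : Icc (-r) (0 : ℝ) => -(s : ℝ)) (by fun_prop)
    simpa [Function.comp_def, add_comm] using h2⟩

theorem linearOrbit_pos {r : ℝ} {B : Matrix (Fin m) (Fin m) ℝ} (hB : Quasipositive B)
    {a : ℝ} (ha : 0 < a) (s : Icc (-r) (0 : ℝ)) (i : Fin m) : 0 < linearOrbit r B a s i :=
  (mul_pos (Real.exp_pos _) ha).trans_le
    (exp_mulVec_ge hB (u := (s : ℝ) + r) (by linarith [s.2.1]) (fun _ => ha.le) i)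

/-- The cone inequality is an equality here, so subtracting this curve from a cone element preserves
that inequality; only positivity remains to be checked. -/
theorem exp_mulVec_linearOrbit (r : ℝ) (B : Matrix (Fin m) (Fin m) ℝ) (a : ℝ)
    (s t : Icc (-r) (0 : ℝ)) :
    exp (((t : ℝ) - s) • B) *ᵥ linearOrbit r B a s = linearOrbit r B a t := by
  change exp (((t : ℝ) - s) • B) *ᵥ (exp (((s : ℝ) + r) • B) *ᵥ fun _ => a)
    = exp (((t : ℝ) + r) • B) *ᵥ fun _ => a
  rw [Matrix.mulVec_mulVec, ← exp_add_smul]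
  congr 3
  ring

theorem linearOrbit_mem_cone {r : ℝ} {B : Matrix (Fin m) (Fin m) ℝ} (hB : Quasipositive B)
    {a : ℝ} (ha : 0 < a) : linearOrbit r B a ∈ cone r B :=
  ⟨fun s i => (linearOrbit_pos hB ha s i).le, fun s t _ i => by
    rw [exp_mulVec_linearOrbit]⟩

/-- An element of the cone which is larger than `(a,…,a)` at `-r` dominates `linearOrbit r B a`. -/
theorem linearOrbit_lt_of_mem_cone {r : ℝ} (hr : 0 < r) {B : Matrix (Fin m) (Fin m) ℝ}
    (hB : Quasipositive B) {a : ℝ} {φ : PhaseSpace r m} (hφ : φ ∈ cone r B)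
    (ha : ∀ i, a < φ ⟨-r, le_rfl, by linarith⟩ i) :
    LEB B (linearOrbit r B a) φ ∧ StrongLT (linearOrbit r B a) φ := by
  have hlt : StrongLT (linearOrbit r B a) φ := by
    intro s i
    have hs : 0 ≤ (s : ℝ) + r := by linarith [s.2.1]
    have h1 := hφ.2 ⟨-r, le_rfl, by linarith⟩ s s.2.1 i
    rw [sub_neg_eq_add] at h1
    refine lt_of_lt_of_le ?_ h1
    have h2 := exp_mulVec_ge hB hs (v := φ ⟨-r, le_rfl, by linarith⟩ - fun _ => a)
      (fun i => (sub_pos.2 (ha i)).le) i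
    have h3 := mul_pos (Real.exp_pos (-(shift B * (s + r)))) (sub_pos.2 (ha i))
    rw [Matrix.mulVec_sub] at h2
    exact sub_pos.1 (h3.trans_le h2)
  refine ⟨⟨fun s i => (sub_pos.2 (hlt s i)).le, fun s t hst i => ?_⟩, hlt⟩
  rw [ContinuousMap.sub_apply, ContinuousMap.sub_apply, Matrix.mulVec_sub,
    exp_mulVec_linearOrbit]
  exact sub_le_sub_right (hφ.2 s t hst i) _

/-- Dominating a small exponential profile. -/
theorem expProfile_le_segment {r : ℝ} {B : Matrix (Fin m) (Fin m) ℝ}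
    (hB : Quasipositive B) {κ ε : ℝ} (hκ : 0 < κ) (hκε : κ * (1 + 2 * entrySum B) ≤ ε)
    {y : C(ℝ, Fin m → ℝ)} {y' : ℝ → Fin m → ℝ} {t : ℝ}
    (hyκ : ∀ u ∈ Icc (t - r) t, ∀ i, κ ≤ y u i)
    (hd : ∀ u ∈ Icc (t - r) t, HasDerivAt y (y' u) u)
    (hle : ∀ u ∈ Icc (t - r) t, ∀ i, (B *ᵥ y u) i + ε ≤ y' u i) :
    LEB B (expProfile r B κ) (segment r y t) := by
  have hb := entrySum_nonneg B
  have hexp : ∀ u ≤ (0 : ℝ), κ * Real.exp ((1 + entrySum B) * u) ≤ κ := by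
    intro u hu
    refine mul_le_of_le_one_right hκ.le (Real.exp_le_one_iff.2 ?_)
    exact mul_nonpos_of_nonneg_of_nonpos (by linarith) hu
  refine ⟨fun s i => ?_, fun s s' hs i => ?_⟩
  · refine sub_nonneg.2 ((hexp s s.2.2).trans (hyκ (t + s) ⟨?_, ?_⟩ i))
    · linarith [s.2.1]
    · linarith [s.2.2]
  -- For the profile `p`, `p' - B p ≤ (1 + 2b) p ≤ κ (1 + 2b) ≤ ε` with `b = entrySum B`, so the
  -- difference satisfies `w' ≥ B w`.
  · refine exp_mulVec_le_of_hasDerivAt hB (s := s) (t := s')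
      (w := fun u => y (t + u) - fun _ => κ * Real.exp ((1 + entrySum B) * u))
      (w' := fun u => y' (t + u) - fun _ =>
        κ * (Real.exp ((1 + entrySum B) * u) * (1 + entrySum B))) hs
      (by fun_prop) (fun u hu => ?_) (fun u hu j => ?_) i
    · have hmem : t + u ∈ Icc (t - r) t := ⟨by linarith [hu.1, s.2.1], by linarith [hu.2, s'.2.2]⟩
      have h := (hd _ hmem).scomp u ((hasDerivAt_id u).const_add t)
      rw [one_smul] at h
      exact h.sub (hasDerivAt_expProfile B κ u)
    · have hmem : t + u ∈ Icc (t - r) t := ⟨by linarith [hu.1, s.2.1], by linarith [hu.2, s'.2.2]⟩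
      have h1 := hle _ hmem j
      have h2 := (abs_le.1 (abs_mulVec_const_le B
        (a := κ * Real.exp ((1 + entrySum B) * u)) (by positivity) j)).1
      have h3 := mul_le_mul_of_nonneg_right (hexp u (by linarith [hu.2, s'.2.2]))
        (show 0 ≤ 1 + 2 * entrySum B by linarith)
      rw [Matrix.mulVec_sub]
      simp only [Pi.sub_apply]
      linarith

/-- Bounds `y' - B y` below by a quantity that depends only on `φ` and `ω`; used with `φ = 0` and
with `φ` a `linearOrbit`. -/
theorem StrongMonotoneCondition.mulVec_add_lt {Ω : Type*} {r : ℝ} {hr : 0 < r}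
    {B : Matrix (Fin m) (Fin m) ℝ} {F : Ω → PhaseSpace r m → Fin m → ℝ}
    (hF3 : StrongMonotoneCondition hr B F) {φ : PhaseSpace r m} {y : C(ℝ, Fin m → ℝ)} {t : ℝ}
    (hle : LEB B φ (segment r y t)) (hlt : StrongLT φ (segment r y t)) (ω : Ω) (i : Fin m) :
    (B *ᵥ y t) i + (F ω φ i - (B *ᵥ atZero hr φ) i) < F ω (segment r y t) i := by
  have h := hF3 ω _ _ hle hlt i
  rw [atZero_segment, Matrix.mulVec_sub, Pi.sub_apply] at h
  linarith

/-! ### Uniform eventual estimates -/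

section Solutions

variable {Ω : Type*} [TopologicalSpace Ω] {σ : Flow ℝ Ω} {r : ℝ}
  {F : Ω → PhaseSpace r m → Fin m → ℝ}

theorem IsSolution.segment_mem_cone_and_pos (hr : 0 < r) {B : Matrix (Fin m) (Fin m) ℝ}
    (hB : Quasipositive B)
    (hF : Continuous fun p : Ω × PhaseSpace r m => F p.1 p.2)
    (hF3 : StrongMonotoneCondition hr B F) (hF0 : ∀ ω i, 0 ≤ F ω 0 i)
    {ω : Ω} {φ : PhaseSpace r m} (hφ : φ ∈ interiorCone r B) {y : C(ℝ, Fin m → ℝ)}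
    (hy : IsSolution σ F ω φ y) {t : ℝ} (ht : 0 ≤ t) :
    segment r y t ∈ cone r B ∧ ∀ s i, 0 < segment r y t s i := by
  have h0 : segment r y 0 ∈ cone r B := by
    rw [hy.1]; exact interiorCone_subset_cone hr hB hφ
  have h0pos : ∀ s i, 0 < segment r y 0 s i := by
    rw [hy.1]; exact hφ.2.1
  have hd : ∀ u ∈ Ioo 0 t, HasDerivAt y (F (σ u ω) (segment r y u)) u :=
    fun u hu => hy.hasDerivAt hu.1
  have hle : ∀ u ∈ Ioo 0 t, ∀ i, (B *ᵥ y u) i ≤ F (σ u ω) (segment r y u) i :=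
    fun u hu i => (hy.mulVec_lt hr hB hF hF3 hF0 hφ hu.1.le i).le
  exact ⟨segment_mem_cone hr hB h0 h0pos ht hd hle, fun s i =>
    pos_of_segment_zero hr hB h0 h0pos hd hle (t := t + s) (by linarith [s.2.1])
      (by linarith [s.2.2]) i⟩

/-- All solutions starting in `interiorCone r B` are eventually bounded below by a common positive
constant. -/
theorem exists_eventual_lower_bound [CompactSpace Ω] (hσ : IsMinimalFlow σ) (hr : 0 < r)
    {B : Matrix (Fin m) (Fin m) ℝ} (hB : Quasipositive B)
    (hF : Continuous fun p : Ω × PhaseSpace r m => F p.1 p.2)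
    (hF3 : StrongMonotoneCondition hr B F) (hF0 : ∀ ω i, 0 ≤ F ω 0 i)
    (hω₀ : ∃ ω₀, ∀ i, 0 < F ω₀ 0 i) :
    ∃ c > 0, ∃ T ≥ 0, ∀ ω, ∀ φ ∈ interiorCone r B, ∀ y, IsSolution σ F ω φ y →
      ∀ t ≥ T, ∀ i, c ≤ y t i := by
  obtain ⟨ω₀, hω₀⟩ := hω₀
  obtain ⟨δ, hδ, hδω₀⟩ : ∃ δ > 0, ∀ i, δ < F ω₀ 0 i := by
    obtain ⟨δ, hδ, h⟩ := (finite_univ (α := Fin m)).isCompact.exists_forall_le'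
      (f := fun i => F ω₀ 0 i) (continuous_of_discreteTopology.continuousOn) (a := 0)
      (fun i _ => hω₀ i)
    exact ⟨δ / 2, by linarith, fun i => by linarith [h i (mem_univ i)]⟩
  have hG : Continuous fun p : ℝ × Ω => F (σ p.1 p.2) 0 :=
    hF.comp ((σ.continuous continuous_fst continuous_snd).prodMk continuous_const)
  -- Joint openness in time and base point yields a neighbourhood `U` and a duration `η`: after a
  -- visit to `U`, the forcing exceeds `δ` throughout time `η`.
  have hopen : IsOpen {p : ℝ × Ω | ∀ i, δ < F (σ p.1 p.2) 0 i} := by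
    rw [ofPred_forall]
    exact isOpen_iInter_of_finite fun i =>
      isOpen_lt continuous_const ((continuous_apply i).comp hG)
  have hnhds := hopen.mem_nhds (x := ((0 : ℝ), ω₀)) (by simpa using hδω₀)
  obtain ⟨V, U, hV, h0V, hU, hU0, hVU⟩ := mem_nhds_prod_iff'.1 hnhds
  obtain ⟨η, hη, hηV⟩ := Metric.isOpen_iff.1 hV 0 h0V
  obtain ⟨T, hT, hret⟩ := hσ.exists_return_time hU ⟨ω₀, hU0⟩
  have hb := entrySum_nonneg B
  have hd0 : 0 < δ / (1 + entrySum B * η) * η := by positivity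
  refine ⟨Real.exp (-(shift B * T)) * (δ / (1 + entrySum B * η) * η),
    mul_pos (Real.exp_pos _) hd0, T + η, by linarith, ?_⟩
  intro ω φ hφ y hy t ht i
  -- Starting the search at `t - T - η` puts the visit `τ` in `[t - T - η, t - η]`: the forcing ends
  -- before `t`, and at most time `T` of decay follows.
  obtain ⟨t₁, ht₁, hmem⟩ := hret (σ (t - T - η) ω)
  rw [← σ.map_add] at hmem
  set τ := t₁ + (t - T - η) with hτ
  have hτ0 : 0 ≤ τ := by linarith [ht₁.1, ht]
  have hpos : ∀ u : ℝ, 0 ≤ u → ∀ i, 0 < y u i := by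
    intro u hu i
    have h := (hy.segment_mem_cone_and_pos hr hB hF hF3 hF0 hφ hu).2 ⟨0, by linarith, le_rfl⟩ i
    simpa [segment] using h
  have hforce : ∀ u ∈ Ioo τ (τ + η), ∀ i,
      (B *ᵥ y u) i + δ ≤ F (σ u ω) (segment r y u) i := by
    intro u hu i
    obtain ⟨hc, hp⟩ := hy.segment_mem_cone_and_pos hr hB hF hF3 hF0 hφ (hτ0.trans hu.1.le)
    have h1 := hF3.mulVec_add_lt (φ := 0) (by simpa [LEB] using hc) hp (σ u ω) i
    have hz : atZero hr (0 : PhaseSpace r m) = 0 := rfl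
    rw [hz, Matrix.mulVec_zero, Pi.zero_apply, sub_zero] at h1
    have h2 : ((u - τ, σ τ ω) : ℝ × Ω) ∈ V ×ˢ U := by
      refine ⟨hηV ?_, hmem⟩
      rw [Metric.mem_ball, Real.dist_eq, sub_zero, abs_of_pos (sub_pos.2 hu.1)]
      linarith [hu.2]
    have h3 := hVU h2 i
    simp only [← σ.map_add, sub_add_cancel] at h3
    linarith
  -- Only `y τ ≥ 0` enters, so the bound does not depend on the initial datum.
  have h1 := lower_bound_of_forcing hB hη hδ y.continuous.continuousOn
    (fun u hu => hy.hasDerivAt (hτ0.trans_lt hu.1)) hforce (fun i => (hpos τ hτ0 i).le)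
  have hτt : τ + η ≤ t := by linarith [ht₁.2]
  have h2 := exp_mulVec_le_of_hasDerivAt hB hτt y.continuous.continuousOn
    (fun u hu => hy.hasDerivAt (by linarith [hu.1]))
    (fun u hu i => (hy.mulVec_lt hr hB hF hF3 hF0 hφ (by linarith [hu.1]) i).le) i
  have h3 := exp_mulVec_ge hB (sub_nonneg.2 hτt) (fun i => (hpos (τ + η) (by linarith) i).le) i
  refine le_trans (mul_le_mul (Real.exp_le_exp.2 ?_) (h1 i) hd0.le (Real.exp_pos _).le)
    (h3.trans h2)
  exact neg_le_neg (mul_le_mul_of_nonneg_left (by linarith [ht₁.1]) (shift_nonneg B))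

/-- All solutions starting in `interiorCone r B` eventually satisfy `y' - B y ≥ ε` for a common `ε > 0`. -/
theorem exists_eventual_forcing [CompactSpace Ω] (hr : 0 < r)
    {B : Matrix (Fin m) (Fin m) ℝ} (hB : Quasipositive B)
    (hF : Continuous fun p : Ω × PhaseSpace r m => F p.1 p.2)
    (hF3 : StrongMonotoneCondition hr B F) (hF0 : ∀ ω i, 0 ≤ F ω 0 i)
    {c T : ℝ} (hc : 0 < c) (hT : 0 ≤ T)
    (hlow : ∀ ω, ∀ φ ∈ interiorCone r B, ∀ y, IsSolution σ F ω φ y →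
      ∀ t ≥ T, ∀ i, c ≤ y t i) :
    ∃ ε > 0, ∀ ω, ∀ φ ∈ interiorCone r B, ∀ y, IsSolution σ F ω φ y →
      ∀ t ≥ T + r, ∀ i, (B *ᵥ y t) i + ε ≤ F (σ t ω) (segment r y t) i := by
  -- The factor `1/2` turns `c ≤ y` into the strict inequality that (F3) requires.
  set χ := linearOrbit r B (c / 2) with hχ
  have hχpos : StrongLT 0 χ := fun s i => linearOrbit_pos hB (by linarith) s i
  have hχcone : χ ∈ cone r B := linearOrbit_mem_cone hB (by linarith)
  have hcont : Continuous fun p : Ω × Fin m => F p.1 χ p.2 - (B *ᵥ atZero hr χ) p.2 := by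
    refine continuous_prod_of_discrete_right.2 fun i => ?_
    have h : Continuous fun ω => F ω χ := hF.comp (continuous_id.prodMk continuous_const)
    exact ((continuous_apply i).comp h).sub (continuous_const (y := (B *ᵥ atZero hr χ) i))
  -- By (F3) against 0, `F(ω,χ) - Bχ(0) > F(ω,0) ≥ 0`; compactness of `Ω × Fin m` makes this
  -- uniform.
  obtain ⟨ε, hε, hεF⟩ := isCompact_univ.exists_forall_le' hcont.continuousOn (a := 0) (by
    rintro ⟨ω, i⟩ -
    have h := hF3 ω 0 χ (by simpa [LEB] using hχcone) hχpos i
    have hz : atZero hr (0 : PhaseSpace r m) = 0 := rfl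
    rw [hz, sub_zero] at h
    have := hF0 ω i
    simp only
    linarith)
  refine ⟨ε, hε, fun ω φ hφ y hy t ht i => ?_⟩
  have hcone := (hy.segment_mem_cone_and_pos hr hB hF hF3 hF0 hφ (t := t) (by linarith)).1
  obtain ⟨hle, hlt⟩ := linearOrbit_lt_of_mem_cone hr hB (a := c / 2) hcone (fun i => by
    have h := hlow ω φ hφ y hy (t + -r) (by linarith) i
    change c / 2 < y (t + -r) i
    linarith)
  have h1 := hF3.mulVec_add_lt hle hlt (σ t ω) i
  have h2 := hεF (σ t ω, i) (mem_univ _)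
  linarith

end Solutions

end ExpOrder

/-! ### Uniform persistence -/

theorem proposition2p6 {Ω : Type*} [MetricSpace Ω] [CompactSpace Ω]
    (σ : Flow ℝ Ω) (hσ : ExpOrder.IsMinimalFlow σ)
    {r : ℝ} (hr : 0 < r) {m : ℕ}
    (B : Matrix (Fin m) (Fin m) ℝ) (hB : ExpOrder.Quasipositive B)
    (F : Ω → ExpOrder.PhaseSpace r m → Fin m → ℝ)
    (hF1 : ExpOrder.IsRegular F)
    (hF3 : ExpOrder.StrongMonotoneCondition hr B F)
    (hglobal : ExpOrder.GloballyDefinedOn σ F (ExpOrder.cone r B))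
    (hF0 : ∀ ω i, 0 ≤ F ω 0 i)
    (hω₀ : ∃ ω₀, ∀ i, 0 < F ω₀ 0 i) :
    ExpOrder.UniformlyPersistent σ B F := by
  obtain ⟨c, hc, T, hT, hlow⟩ :=
    ExpOrder.exists_eventual_lower_bound hσ hr hB hF1.continuous hF3 hF0 hω₀
  obtain ⟨ε, hε, hforce⟩ :=
    ExpOrder.exists_eventual_forcing hr hB hF1.continuous hF3 hF0 hc hT hlow
  have hb := ExpOrder.entrySum_nonneg B
  have hden : 0 < 1 + 2 * ExpOrder.entrySum B := by linarith
  -- The first bound on `κ` keeps the profile below `y`, the second is the slope condition of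
  -- `expProfile_le_segment`. The threshold `T + 2 * r` makes the forcing, valid from `T + r`,
  -- available on all of `[t - r, t]`.
  have hκ : 0 < min c (ε / (1 + 2 * ExpOrder.entrySum B)) := lt_min hc (div_pos hε hden)
  refine ⟨ExpOrder.expProfile r B (min c (ε / (1 + 2 * ExpOrder.entrySum B))),
    ExpOrder.expProfile_mem_interiorCone hr B hκ, fun ω φ hφ =>
    ⟨hglobal ω φ (ExpOrder.interiorCone_subset_cone hr hB hφ), T + 2 * r, by linarith,
      fun y hy t ht => ?_⟩⟩
  refine ExpOrder.expProfile_le_segment hB hκ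
    ((le_div_iff₀ hden).1 (min_le_right _ _))
    (y' := fun u => F (σ u ω) (ExpOrder.segment r y u)) ?_ ?_ ?_
  · exact fun u hu i => (min_le_left _ _).trans
      (hlow ω φ hφ y hy u (by linarith [hu.1]) i)
  · exact fun u hu => hy.hasDerivAt (by linarith [hu.1])
  · exact fun u hu i => hforce ω φ hφ y hy u (by linarith [hu.1]) i
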